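/- For a real base $\beta>1$ put $\ell=\frac{-\beta}{\beta+1}$, $T_{-\beta}(x)=-\beta x-\lfloor-\beta x-\ell\rfloor$ and, for $x\in[\ell,\ell+1)$, $d_{-\beta}(x)=x_1x_2x_3\cdots$ with $x_i=\lfloor-\beta T_{-\beta}^{i-1}(x)-\ell\rfloor$. For $x\in\mathbb R$ let $k\ge 0$ be the minimal integer with $x/(-\beta)^k\in(\ell,\ell+1)$ and let $d_{-\beta}(x/(-\beta)^k)=x_1x_2x_3\cdots$; the $(-\beta)$-expansion of $x$ is $x_1\cdots x_k\bullet x_{k+1}x_{k+2}\cdots$ (and $0\bullet x_1x_2\cdots$ if $k=0$). Let $\mathrm{fr}(x)$ be the least $n\ge 0$ such that all digits of this expansion after the $n$-th fractional digit are zero, and $\mathrm{fr}(x)=+\infty$ if there is no such $n$. Let $\operatorname{Fin}(-\beta)=\{x:\mathrm{fr}(x)<\infty\}$, let $\mathbb Z_{-\beta}=\{x:\mathrm{fr}(x)=0\}$ be the set of $(-\beta)$-integers, and let $L_\oplus(-\beta)$ be the maximum (supremum) of $\mathrm{fr}(z)$ over all $z\in\operatorname{Fin}(-\beta)$ of the form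 $z=x+y$ or $z=x-y$ with $x,y\in\mathbb Z_{-\beta}$. **Theorem.** Let $\gamma$ be the real zero of $x^3-x^2-x-1$. If $x,y\in\mathbb Z_{-\gamma}$, then $x+y$, $-x$ and $x-y$ belong to $\operatorname{Fin}(-\gamma)$ and $\mathrm{fr}(x+y)\le 6$, $\mathrm{fr}(-x)\le 6$, $\mathrm{fr}(x-y)\le 6$. Moreover, the number $2\gamma^2-\gamma+2$ is a sum of two $(-\gamma)$-integers, its $(-\gamma)$-expansion is $11110\bullet011001$, and hence $\mathrm{fr}(2\gamma^2-\gamma+2)=6$. Consequently $L_\oplus(-\gamma)=6$. -/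

import Mathlib

namespace ItoSadahiro

noncomputable section

/-- The left end-point `ℓ = -β / (β + 1)` of the fundamental interval `[ℓ, ℓ + 1)`. -/
def ell (β : ℝ) : ℝ := -β / (β + 1)

/-- The Ito-Sadahiro transformation `T_{-β}(x) = -β x - ⌊-β x - ℓ⌋`. -/
def transf (β x : ℝ) : ℝ := -β * x - (⌊-β * x - ell β⌋ : ℤ)

/-- The digits of `d_{-β}(x)` for `x ∈ [ℓ, ℓ + 1)`, counted from `0`:
`digit β x i = ⌊-β T_{-β}^i(x) - ℓ⌋` is the digit usually written `x_{i+1}`. -/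
def digit (β x : ℝ) (i : ℕ) : ℤ := ⌊-β * (transf β)^[i] x - ell β⌋

/-- The minimal `k ∈ ℕ` (zero included) with `x / (-β)^k ∈ (ℓ, ℓ + 1)`. -/
def shift (β x : ℝ) : ℕ := sInf {k : ℕ | x / (-β) ^ k ∈ Set.Ioo (ell β) (ell β + 1)}

/-- The `(-β)`-expansion of the real number `x`, as the function that maps `j : ℤ` to the
coefficient of `(-β)^j`. With `k = shift β x` and `d_{-β}(x / (-β)^k) = x₁x₂x₃⋯`, the expansion
is `x₁⋯x_k • x_{k+1}x_{k+2}⋯`, so that the coefficient of `(-β)^j` is `x_{k-j}` for `j < k`, and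
there is no digit at the positions `j ≥ k`. -/
def expansion (β x : ℝ) (j : ℤ) : ℤ :=
  if j < (shift β x : ℤ) then
    digit β (x / (-β) ^ (shift β x)) ((shift β x : ℤ) - 1 - j).toNat
  else 0

/-- The set `ℤ_{-β}` of `(-β)`-integers: all fractional digits of the expansion vanish. -/
def negIntegers (β : ℝ) : Set ℝ := {x | ∀ j : ℤ, j < 0 → expansion β x j = 0}

/-- The set `Fin(-β)` of numbers with finite `(-β)`-expansion. -/
def negFin (β : ℝ) : Set ℝ := {x | ∃ n : ℕ, ∀ j : ℤ, j < -(n : ℤ) → expansion β x j = 0}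

/-- The length `fr(x)` of the fractional part of the `(-β)`-expansion of `x`: the least `n` such
that no non-zero digit stands to the right of position `-n`, and `⊤` if there is no such `n`. -/
def fr (β x : ℝ) : ℕ∞ :=
  ⨅ (n : ℕ) (_ : ∀ j : ℤ, j < -(n : ℤ) → expansion β x j = 0), (n : ℕ∞)

/-- `L_⊕(-β)`: the maximal length of the fractional part of those sums and differences of two
`(-β)`-integers that have a finite `(-β)`-expansion. -/
def LPlus (β : ℝ) : ℕ∞ :=
  sSup {n : ℕ∞ | ∃ x ∈ negIntegers β, ∃ y ∈ negIntegers β, ∃ z : ℝ,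
    (z = x + y ∨ z = x - y) ∧ z ∈ negFin β ∧ n = fr β z}

end

end ItoSadahiro

namespace ItoSadahiro

open Filter Topology

/-! ### The transformation and the expansion for a general base `β > 1` -/

section General

variable {β x u : ℝ}

/-! Scale `x`, `y` and `z = x ± y` by a common large power of `-γ` and run the transformation on all
three. The remainder of `z` minus the corresponding combination of the remainders of `x` and `y` is
a state `s` with `s₀ = 0` and `s ↦ -γ s + d`, where `d` comes from a short list. The state stays in
a fixed interval and lies in `ℤ[γ]`. Since `γ` is Pisot, the conjugates of the states are bounded
too, so only finitely many states occur.

When the integer parts are used up, the remainders of `x` and `y` are zero, so the state is the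
remainder of `z`. It remains to check that six more steps send every such state to `0`. This is a
finite computation in integer coordinates with rational enclosures (`terminates_sum`,
`terminates_difference`), transferred to real numbers by `Terminates.iterate_eq_zero`. An explicit
example attains six. -/

lemma ell_mul (hβ : 1 < β) : ell β * (β + 1) = -β := by
  unfold ell; field_simp

lemma ell_neg (hβ : 1 < β) : ell β < 0 := by
  have := ell_mul hβ
  nlinarith

lemma ell_add_one_pos (hβ : 1 < β) : 0 < ell β + 1 := by
  have := ell_mul hβ
  nlinarith

lemma transf_eq (β u : ℝ) : transf β u = -β * u - (digit β u 0 : ℤ) := rfl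

lemma digit_succ (β u : ℝ) (i : ℕ) : digit β u (i + 1) = digit β (transf β u) i := rfl

lemma digit_add (β u : ℝ) (m i : ℕ) : digit β u (m + i) = digit β ((transf β)^[m] u) i := by
  simp only [digit]
  rw [Nat.add_comm, Function.iterate_add_apply]

lemma iterate_transf_succ (β u : ℝ) (i : ℕ) :
    (transf β)^[i + 1] u = -β * (transf β)^[i] u - (digit β u i : ℤ) := by
  rw [Function.iterate_succ_apply', transf_eq]; rfl

lemma transf_mem_Ico (β u : ℝ) : transf β u ∈ Set.Ico (ell β) (ell β + 1) := by
  have h1 := Int.floor_le (-β * u - ell β)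
  have h2 := Int.lt_floor_add_one (-β * u - ell β)
  constructor <;> unfold transf <;> linarith

lemma iterate_transf_mem_Ico (hu : u ∈ Set.Ico (ell β) (ell β + 1)) (i : ℕ) :
    (transf β)^[i] u ∈ Set.Ico (ell β) (ell β + 1) := by
  cases i with
  | zero => exact hu
  | succ i => rw [Function.iterate_succ_apply']; exact transf_mem_Ico _ _

lemma digit_zero_eq (d : ℤ) (h : -β * u - d ∈ Set.Ico (ell β) (ell β + 1)) :
    digit β u 0 = d := by
  have h1 := h.1
  have h2 := h.2
  simp only [digit, Function.iterate_zero, id]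
  rw [Int.floor_eq_iff]
  constructor <;> linarith

lemma zero_mem_Ico (hβ : 1 < β) : (0 : ℝ) ∈ Set.Ico (ell β) (ell β + 1) :=
  ⟨(ell_neg hβ).le, ell_add_one_pos hβ⟩

lemma transf_zero (hβ : 1 < β) : transf β 0 = 0 := by
  rw [transf_eq, digit_zero_eq 0 (by simpa using zero_mem_Ico hβ)]; simp

lemma iterate_transf_zero (hβ : 1 < β) (i : ℕ) : (transf β)^[i] 0 = 0 :=
  Function.iterate_fixed (transf_zero hβ) i

lemma digit_of_zero (hβ : 1 < β) (i : ℕ) : digit β 0 i = 0 := by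
  have := digit_add β 0 i 0
  rw [iterate_transf_zero hβ] at this
  rw [add_zero] at this
  rw [this]
  exact digit_zero_eq 0 (by simpa using zero_mem_Ico hβ)

/-- The interval must be open: `ℓ / (-β) = ℓ + 1`. -/
lemma div_neg_mem_Ioo (hβ : 1 < β) (hu : u ∈ Set.Ioo (ell β) (ell β + 1)) :
    u / (-β) ∈ Set.Ioo (ell β) (ell β + 1) := by
  obtain ⟨h1, h2⟩ := hu
  have h := ell_mul hβ
  have he := ell_neg hβ
  rw [div_neg, ← neg_div]
  constructor
  · rw [lt_div_iff₀ (by linarith)]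
    nlinarith
  · rw [div_lt_iff₀ (by linarith)]
    nlinarith

lemma transf_div_neg (hβ : 1 < β) (hu : u ∈ Set.Ico (ell β) (ell β + 1)) :
    digit β (u / (-β)) 0 = 0 ∧ transf β (u / (-β)) = u := by
  have hb : β ≠ 0 := by linarith
  have he : -β * (u / (-β)) = u := by field_simp
  have hd : digit β (u / (-β)) 0 = 0 := digit_zero_eq 0 (by rw [he]; simpa using hu)
  exact ⟨hd, by rw [transf_eq, hd, he]; simp⟩

lemma div_pow_mem_Ioo_mono (hβ : 1 < β) {m n : ℕ} (hmn : m ≤ n)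
    (h : x / (-β) ^ m ∈ Set.Ioo (ell β) (ell β + 1)) :
    x / (-β) ^ n ∈ Set.Ioo (ell β) (ell β + 1) := by
  induction n, hmn using Nat.le_induction with
  | base => exact h
  | succ n _ ih => rw [pow_succ, ← div_div]; exact div_neg_mem_Ioo hβ ih

lemma eventually_div_pow_mem_Ioo (hβ : 1 < β) (x : ℝ) :
    ∀ᶠ k : ℕ in atTop, x / (-β) ^ k ∈ Set.Ioo (ell β) (ell β + 1) := by
  have hb : |(-β)⁻¹| < 1 := by
    rw [abs_inv, abs_neg, abs_of_pos (by linarith)]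
    exact inv_lt_one_of_one_lt₀ hβ
  have h : Tendsto (fun k : ℕ => x / (-β) ^ k) atTop (𝓝 0) := by
    have := (tendsto_pow_atTop_nhds_zero_of_abs_lt_one hb).const_mul x
    simpa only [div_eq_mul_inv, inv_pow, mul_zero] using this
  exact h.eventually (Ioo_mem_nhds (ell_neg hβ) (ell_add_one_pos hβ))

lemma shift_mem_Ioo (hβ : 1 < β) (x : ℝ) :
    x / (-β) ^ shift β x ∈ Set.Ioo (ell β) (ell β + 1) :=
  Nat.sInf_mem (s := {k : ℕ | x / (-β) ^ k ∈ Set.Ioo (ell β) (ell β + 1)})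
    (eventually_div_pow_mem_Ioo hβ x).exists

/-- Each further division by `-β` prepends a digit `0`, which leaves the digit at every position `j`
unchanged. -/
lemma expansion_of_shift_le (hβ : 1 < β) {K : ℕ} (hK : shift β x ≤ K) (j : ℤ) :
    expansion β x j =
      if j < (K : ℤ) then digit β (x / (-β) ^ K) ((K : ℤ) - 1 - j).toNat else 0 := by
  induction K, hK using Nat.le_induction with
  | base => rfl
  | succ n hn ih =>
    have hmem := Set.Ioo_subset_Ico_self (div_pow_mem_Ioo_mono hβ hn (shift_mem_Ioo hβ x))
    obtain ⟨hd, ht⟩ := transf_div_neg hβ hmem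
    rw [ih, pow_succ, ← div_div]
    rcases lt_trichotomy j (n : ℤ) with h | h | h
    · have e : (((n + 1 : ℕ) : ℤ) - 1 - j).toNat = ((n : ℤ) - 1 - j).toNat + 1 := by omega
      rw [if_pos h, if_pos (by omega), e, digit_succ, ht]
    · have e : (((n + 1 : ℕ) : ℤ) - 1 - j).toNat = 0 := by omega
      rw [if_neg (by omega), if_pos (by omega), e, hd]
    · rw [if_neg (by omega), if_neg (by omega)]

/-- The expansion may be read off from `x / (-β)^K` for every admissible, not only for the
minimal, exponent `K`. -/
lemma expansion_eq (hβ : 1 < β) {K : ℕ} (hK : x / (-β) ^ K ∈ Set.Ioo (ell β) (ell β + 1))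
    (j : ℤ) :
    expansion β x j =
      if j < (K : ℤ) then digit β (x / (-β) ^ K) ((K : ℤ) - 1 - j).toNat else 0 :=
  expansion_of_shift_le hβ (Nat.sInf_le hK) j

/-- With zero digits the iterates are `(-β)^i u`, which are unbounded unless `u = 0`. -/
lemma eq_zero_of_digits_zero (hβ : 1 < β) (hu : u ∈ Set.Ico (ell β) (ell β + 1))
    (h : ∀ i, digit β u i = 0) : u = 0 := by
  have hit : ∀ i, (transf β)^[i] u = (-β) ^ i * u := by
    intro i
    induction i with
    | zero => simp
    | succ i ih => rw [iterate_transf_succ, ih, h i, pow_succ]; push_cast; ring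
  by_contra hne
  obtain ⟨n, hn⟩ := pow_unbounded_of_one_lt (1 / |u|) hβ
  have hpos : 0 < |u| := abs_pos.mpr hne
  rw [div_lt_iff₀ hpos] at hn
  have hm := iterate_transf_mem_Ico hu n
  rw [hit] at hm
  have habs : |(-β) ^ n * u| = β ^ n * |u| := by
    rw [abs_mul, abs_pow, abs_neg, abs_of_pos (by linarith)]
  have : |(-β) ^ n * u| ≤ 1 := by
    have := ell_neg hβ
    have := ell_add_one_pos hβ
    rw [abs_le]
    exact ⟨by linarith [hm.1], by linarith [hm.2]⟩
  linarith

lemma iterate_transf_eq_zero_of_mem_negIntegers (hβ : 1 < β) (hx : x ∈ negIntegers β) {K : ℕ}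
    (hK : x / (-β) ^ K ∈ Set.Ioo (ell β) (ell β + 1)) :
    (transf β)^[K] (x / (-β) ^ K) = 0 := by
  refine eq_zero_of_digits_zero hβ
    (iterate_transf_mem_Ico (Set.Ioo_subset_Ico_self hK) K) fun i => ?_
  rw [← digit_add]
  have h := hx (-1 - (i : ℤ)) (by omega)
  rw [expansion_eq hβ hK, if_pos (by omega)] at h
  rw [← h]
  congr 1
  omega

lemma expansion_eq_zero_of_iterate (hβ : 1 < β) {K n : ℕ}
    (hK : x / (-β) ^ K ∈ Set.Ioo (ell β) (ell β + 1))
    (h : (transf β)^[K + n] (x / (-β) ^ K) = 0) {j : ℤ} (hj : j < -(n : ℤ)) :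
    expansion β x j = 0 := by
  rw [expansion_eq hβ hK, if_pos (by omega)]
  have e : ((K : ℤ) - 1 - j).toNat = (K + n) + (-1 - n - j).toNat := by omega
  rw [e, digit_add, h, digit_of_zero hβ]

lemma fr_le {n : ℕ} (h : ∀ j : ℤ, j < -(n : ℤ) → expansion β x j = 0) : fr β x ≤ n :=
  iInf₂_le n h

lemma le_fr {n : ℕ} (h : expansion β x (-(n : ℤ)) ≠ 0) : (n : ℕ∞) ≤ fr β x := by
  refine le_iInf₂ fun m hm => ?_
  by_contra hlt
  rw [not_le, Nat.cast_lt] at hlt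
  exact h (hm _ (by omega))

lemma zero_mem_negIntegers (hβ : 1 < β) : (0 : ℝ) ∈ negIntegers β := by
  intro j hj
  refine expansion_eq_zero_of_iterate hβ (K := 0) (n := 0) ?_ (by simp) (by simpa using hj)
  simpa using ⟨ell_neg hβ, ell_add_one_pos hβ⟩

end General

/-! ### The Tribonacci base -/

section Tribonacci

variable {γ : ℝ}

lemma tribonacci_bounds (hγ : γ ^ 3 - γ ^ 2 - γ - 1 = 0) :
    1.839286 < γ ∧ γ < 1.839287 := by
  -- The cubic equals `(γ - 1)² (γ + 1) - 2`, which is negative for `γ ≤ 1`.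
  have h1 : 1 < γ := by
    by_contra h
    push Not at h
    nlinarith [sq_nonneg (γ - 1), sq_nonneg (γ + 1), mul_nonneg (sub_nonneg.mpr h) (sq_nonneg γ),
      mul_nonneg (sub_nonneg.mpr h) (sq_nonneg (γ + 1))]
  constructor
  · by_contra h
    push Not at h
    nlinarith [mul_nonneg (sub_nonneg.mpr h) (sq_nonneg γ),
      mul_nonneg (sub_nonneg.mpr h) (sub_nonneg.mpr h1.le)]
  · by_contra h
    push Not at h
    nlinarith [mul_nonneg (sub_nonneg.mpr h) (sq_nonneg γ),
      mul_nonneg (sub_nonneg.mpr h) (sub_nonneg.mpr h1.le)]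

lemma tribonacci_sq_bounds (hγ : γ ^ 3 - γ ^ 2 - γ - 1 = 0) :
    3.382972 < γ ^ 2 ∧ γ ^ 2 < 3.382977 := by
  obtain ⟨h1, h2⟩ := tribonacci_bounds hγ
  constructor <;> nlinarith

lemma one_lt_tribonacci (hγ : γ ^ 3 - γ ^ 2 - γ - 1 = 0) : 1 < γ := by
  linarith [(tribonacci_bounds hγ).1]

lemma ell_tribonacci_bounds (hγ : γ ^ 3 - γ ^ 2 - γ - 1 = 0) :
    -0.647799 < ell γ ∧ ell γ < -0.647798 := by
  obtain ⟨h1, h2⟩ := tribonacci_bounds hγ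
  have := ell_mul (one_lt_tribonacci hγ)
  constructor <;> nlinarith

/-- The element `a + b γ + c γ²` of `ℤ[γ]`. -/
def value (γ : ℝ) (t : ℤ × ℤ × ℤ) : ℝ := t.1 + t.2.1 * γ + t.2.2 * γ ^ 2

/-- Coordinates of `-γ s + d` in the basis `1, γ, γ²`. -/
def next (s : ℤ × ℤ × ℤ) (d : ℤ) : ℤ × ℤ × ℤ := (d - s.2.2, -s.1 - s.2.2, -s.2.1 - s.2.2)

/-- An integer lower bound of `10⁶ · value γ t`. -/
def lower (t : ℤ × ℤ × ℤ) : ℤ :=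
  1000000 * t.1 + min (1839286 * t.2.1) (1839287 * t.2.1) +
    min (3382972 * t.2.2) (3382977 * t.2.2)

/-- An integer upper bound of `10⁶ · value γ t`. -/
def upper (t : ℤ × ℤ × ℤ) : ℤ :=
  1000000 * t.1 + max (1839286 * t.2.1) (1839287 * t.2.1) +
    max (3382972 * t.2.2) (3382977 * t.2.2)

lemma value_next (hγ : γ ^ 3 - γ ^ 2 - γ - 1 = 0) (s : ℤ × ℤ × ℤ) (d : ℤ) :
    value γ (next s d) = -γ * value γ s + d := by
  simp only [value, next]
  push_cast
  linear_combination (s.2.2 : ℝ) * hγ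

lemma min_mul_le_mul {p q r : ℝ} (b : ℝ) (hp : p ≤ r) (hq : r ≤ q) :
    min (p * b) (q * b) ≤ r * b := by
  rcases le_total 0 b with hb | hb
  · exact (min_le_left _ _).trans (mul_le_mul_of_nonneg_right hp hb)
  · exact (min_le_right _ _).trans (mul_le_mul_of_nonpos_right hq hb)

lemma mul_le_max_mul {p q r : ℝ} (b : ℝ) (hp : p ≤ r) (hq : r ≤ q) :
    r * b ≤ max (p * b) (q * b) := by
  rcases le_total 0 b with hb | hb
  · exact (mul_le_mul_of_nonneg_right hq hb).trans (le_max_right _ _)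
  · exact (mul_le_mul_of_nonpos_right hp hb).trans (le_max_left _ _)

lemma lower_le (hγ : γ ^ 3 - γ ^ 2 - γ - 1 = 0) (t : ℤ × ℤ × ℤ) :
    (lower t : ℝ) ≤ 1000000 * value γ t := by
  obtain ⟨h1, h2⟩ := tribonacci_bounds hγ
  obtain ⟨h3, h4⟩ := tribonacci_sq_bounds hγ
  have hb := min_mul_le_mul (p := 1839286) (q := 1839287) (r := 1000000 * γ) (t.2.1 : ℝ)
    (by linarith) (by linarith)
  have hc := min_mul_le_mul (p := 3382972) (q := 3382977) (r := 1000000 * γ ^ 2) (t.2.2 : ℝ)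
    (by linarith) (by linarith)
  simp only [lower, value]
  push_cast
  linarith

lemma le_upper (hγ : γ ^ 3 - γ ^ 2 - γ - 1 = 0) (t : ℤ × ℤ × ℤ) :
    1000000 * value γ t ≤ (upper t : ℝ) := by
  obtain ⟨h1, h2⟩ := tribonacci_bounds hγ
  obtain ⟨h3, h4⟩ := tribonacci_sq_bounds hγ
  have hb := mul_le_max_mul (p := 1839286) (q := 1839287) (r := 1000000 * γ) (t.2.1 : ℝ)
    (by linarith) (by linarith)
  have hc := mul_le_max_mul (p := 3382972) (q := 3382977) (r := 1000000 * γ ^ 2) (t.2.2 : ℝ)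
    (by linarith) (by linarith)
  simp only [upper, value]
  push_cast
  linarith

/-! ### Expansions of concrete elements of `ℤ[γ]` -/

/-- A sufficient condition for `value γ t` to lie in the interior of the fundamental interval. -/
def Inside (t : ℤ × ℤ × ℤ) : Prop := -647798 ≤ lower t ∧ upper t ≤ 352201

instance (t : ℤ × ℤ × ℤ) : Decidable (Inside t) := inferInstanceAs (Decidable (_ ∧ _))

/-- The thresholds of `Inside` round the end-points inwards, so that membership is certified; those
of `Terminates` round outwards, so that no state is lost. -/
lemma Inside.mem_Ioo (hγ : γ ^ 3 - γ ^ 2 - γ - 1 = 0) {t : ℤ × ℤ × ℤ} (h : Inside t) :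
    value γ t ∈ Set.Ioo (ell γ) (ell γ + 1) := by
  obtain ⟨h1, h2⟩ := ell_tribonacci_bounds hγ
  have h3 := lower_le hγ t
  have h4 := le_upper hγ t
  have h5 : (-647798 : ℝ) ≤ lower t := by exact_mod_cast h.1
  have h6 : (upper t : ℝ) ≤ 352201 := by exact_mod_cast h.2
  constructor <;> linarith

/-- `HasDigits ds t` certifies that `value γ t` has the digit string `ds` followed by zeros. -/
def HasDigits : List ℤ → ℤ × ℤ × ℤ → Prop
  | [], t => t = 0
  | d :: ds, t => Inside t ∧ HasDigits ds (next t (-d))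

instance HasDigits.decidable : (ds : List ℤ) → ∀ t, Decidable (HasDigits ds t)
  | [], t => inferInstanceAs (Decidable (t = 0))
  | _ :: ds, _ =>
    have := HasDigits.decidable ds
    inferInstanceAs (Decidable (_ ∧ _))

lemma HasDigits.mem_Ioo (hγ : γ ^ 3 - γ ^ 2 - γ - 1 = 0) {ds : List ℤ} {t : ℤ × ℤ × ℤ}
    (h : HasDigits ds t) : value γ t ∈ Set.Ioo (ell γ) (ell γ + 1) := by
  cases ds with
  | nil =>
    have hβ := one_lt_tribonacci hγ
    simp only [HasDigits] at h
    simpa [h, value] using ⟨ell_neg hβ, ell_add_one_pos hβ⟩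
  | cons d ds => exact Inside.mem_Ioo hγ h.1

lemma HasDigits.digit_eq (hγ : γ ^ 3 - γ ^ 2 - γ - 1 = 0) {ds : List ℤ} {t : ℤ × ℤ × ℤ}
    (h : HasDigits ds t) (i : ℕ) : digit γ (value γ t) i = ds.getD i 0 := by
  induction ds generalizing t i with
  | nil =>
    simp only [HasDigits] at h
    simpa [h, value] using digit_of_zero (one_lt_tribonacci hγ) i
  | cons d ds ih =>
    have hn : value γ (next t (-d)) = -γ * value γ t - d := by
      rw [value_next hγ]; push_cast; ring
    have h0 : digit γ (value γ t) 0 = d :=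
      digit_zero_eq d (hn ▸ Set.Ioo_subset_Ico_self (h.2.mem_Ioo hγ))
    cases i with
    | zero => simpa using h0
    | succ i =>
      rw [digit_succ, transf_eq, h0, ← hn, ih h.2]
      simp

lemma HasDigits.expansion_eq (hγ : γ ^ 3 - γ ^ 2 - γ - 1 = 0) {ds : List ℤ} {t : ℤ × ℤ × ℤ}
    (h : HasDigits ds t) (K : ℕ) (j : ℤ) :
    expansion γ ((-γ) ^ K * value γ t) j =
      if j < (K : ℤ) then ds.getD ((K : ℤ) - 1 - j).toNat 0 else 0 := by
  have hβ := one_lt_tribonacci hγ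
  have he : (-γ) ^ K * value γ t / (-γ) ^ K = value γ t :=
    mul_div_cancel_left₀ _ (pow_ne_zero _ (by linarith))
  rw [ItoSadahiro.expansion_eq hβ (K := K) (by rw [he]; exact h.mem_Ioo hγ), he, h.digit_eq hγ]

lemma HasDigits.mem_negIntegers (hγ : γ ^ 3 - γ ^ 2 - γ - 1 = 0) {ds : List ℤ}
    {t : ℤ × ℤ × ℤ} (h : HasDigits ds t) :
    (-γ) ^ ds.length * value γ t ∈ negIntegers γ := by
  intro j hj
  rw [h.expansion_eq hγ, if_pos (by omega), List.getD_eq_default _ _ (by omega)]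

/-! ### The remainders of a sum or difference -/

/-- The successors of the states in `S` under `s ↦ -γ s + d` with `d ∈ D` that may lie in the
interval `(lo / 10⁶, hi / 10⁶)`. -/
def successors (D : List ℤ) (lo hi : ℤ) (S : List (ℤ × ℤ × ℤ)) : List (ℤ × ℤ × ℤ) :=
  ((S.flatMap fun s => D.map (next s)).filter fun t => lower t < hi ∧ lo < upper t).dedup

lemma exists_mem_successors (hγ : γ ^ 3 - γ ^ 2 - γ - 1 = 0) {D : List ℤ} {lo hi : ℤ}
    {S : List (ℤ × ℤ × ℤ)} {r r' : ℝ} {d : ℤ} (hr : ∃ s ∈ S, value γ s = r) (hd : d ∈ D)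
    (hr' : r' = -γ * r + d) (hlo : (lo : ℝ) < 1000000 * r') (hhi : 1000000 * r' < hi) :
    ∃ s ∈ successors D lo hi S, value γ s = r' := by
  obtain ⟨s, hs, rfl⟩ := hr
  have hv : value γ (next s d) = r' := by rw [value_next hγ, hr']
  refine ⟨next s d, ?_, hv⟩
  have h1 := lower_le hγ (next s d)
  have h2 := le_upper hγ (next s d)
  rw [hv] at h1 h2
  simp only [successors, List.mem_dedup, List.mem_filter, List.mem_flatMap, List.mem_map,
    decide_eq_true_eq]
  exact ⟨⟨s, hs, d, hd, rfl⟩, by exact_mod_cast h1.trans_lt hhi, by exact_mod_cast hlo.trans_le h2⟩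

/-- The states reached from `0` in at most `n` steps. -/
def reachable (D : List ℤ) (lo hi : ℤ) : ℕ → List (ℤ × ℤ × ℤ)
  | 0 => [0]
  | n + 1 => reachable D lo hi n ∪ successors D lo hi (reachable D lo hi n)

/-- All states reached from `0` that may lie in the fundamental interval are sent to `0` by
`n` applications of the transformation. -/
def Terminates (D : List ℤ) (lo hi : ℤ) (m n : ℕ) : Prop :=
  successors D lo hi (reachable D lo hi m) ⊆ reachable D lo hi m ∧
  (successors [0, -1] (-647799) 352202)^[n]
    ((reachable D lo hi m).filter fun t => lower t < 352202 ∧ -647799 < upper t) ⊆ [0]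

instance (D : List ℤ) (lo hi : ℤ) (m n : ℕ) : Decidable (Terminates D lo hi m n) :=
  inferInstanceAs (Decidable (_ ∧ _))

lemma zero_mem_reachable (D : List ℤ) (lo hi : ℤ) (m : ℕ) :
    (0 : ℤ × ℤ × ℤ) ∈ reachable D lo hi m := by
  induction m with
  | zero => simp [reachable]
  | succ m ih => simp [reachable, ih]

/-- For remainders in `[ℓ, ℓ + 1)`, `r_z - r_x - r_y` lies between `-ℓ - 2 ≈ -1.352` and `1 - ℓ ≈
1.648`; the bounds round this outwards. Twelve rounds already give a set closed under successors. -/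
lemma terminates_sum : Terminates [-1, 0, 1, 2] (-1360000) 1660000 12 6 := by
  decide +kernel

/-- Here `r_z - r_x + r_y` lies between `ℓ - 1 ≈ -1.648` and `ℓ + 2 ≈ 1.352`; the upper bound used
is generous. -/
lemma terminates_difference : Terminates [-2, -1, 0, 1] (-1660000) 2360000 12 6 := by
  decide +kernel

/-- As `r` runs over `[ℓ, ℓ + 1)`, `-γ r - ℓ` runs over `(0, γ]`, and `γ < 2`. -/
lemma digit_eq_zero_or_one (hγ : γ ^ 3 - γ ^ 2 - γ - 1 = 0) {u : ℝ}
    (hu : u ∈ Set.Ico (ell γ) (ell γ + 1)) (i : ℕ) :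
    digit γ u i = 0 ∨ digit γ u i = 1 := by
  have hm := iterate_transf_mem_Ico hu i
  have hβ := one_lt_tribonacci hγ
  have h := ell_mul hβ
  obtain ⟨h3, h4⟩ := tribonacci_bounds hγ
  have h1 : (0 : ℝ) ≤ -γ * (transf γ)^[i] u - ell γ := by nlinarith [hm.2]
  have h2 : -γ * (transf γ)^[i] u - ell γ < 2 := by nlinarith [hm.1]
  have h5 : 0 ≤ digit γ u i := Int.floor_nonneg.mpr h1
  have h6 : digit γ u i < 2 := Int.floor_lt.mpr (by exact_mod_cast h2)
  omega

lemma mem_Ico_scaled (hγ : γ ^ 3 - γ ^ 2 - γ - 1 = 0) {r : ℝ}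
    (hr : r ∈ Set.Ico (ell γ) (ell γ + 1)) :
    ((-647799 : ℤ) : ℝ) < 1000000 * r ∧ 1000000 * r < ((352202 : ℤ) : ℝ) := by
  obtain ⟨h1, h2⟩ := ell_tribonacci_bounds hγ
  push_cast
  exact ⟨by linarith [hr.1], by linarith [hr.2]⟩

/-- If the differences `s` between the remainders of `z` and those of its summands evolve within
a terminating system of states, and vanish for the integer parts, then `z` has at most `n`
fractional digits. -/
lemma Terminates.iterate_eq_zero (hγ : γ ^ 3 - γ ^ 2 - γ - 1 = 0) {D : List ℤ} {lo hi : ℤ}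
    {m n K : ℕ} (hT : Terminates D lo hi m n) {s : ℕ → ℝ} {d : ℕ → ℤ} {u : ℝ} (h0 : s 0 = 0)
    (hs : ∀ i, s (i + 1) = -γ * s i + d i) (hd : ∀ i, d i ∈ D)
    (hb : ∀ i, (lo : ℝ) < 1000000 * s i ∧ 1000000 * s i < hi)
    (hu : u ∈ Set.Ico (ell γ) (ell γ + 1)) (hK : (transf γ)^[K] u = s K) :
    (transf γ)^[K + n] u = 0 := by
  have hreach : ∀ i, ∃ t ∈ reachable D lo hi m, value γ t = s i := by
    intro i
    induction i with
    | zero => exact ⟨0, zero_mem_reachable D lo hi m, by simp [value, h0]⟩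
    | succ i ih =>
      obtain ⟨t, ht, hv⟩ :=
        exists_mem_successors hγ ih (hd i) (hs i) (hb (i + 1)).1 (hb (i + 1)).2
      exact ⟨t, hT.1 ht, hv⟩
  have htail : ∀ i, ∃ t ∈ (successors [0, -1] (-647799) 352202)^[i]
      ((reachable D lo hi m).filter fun t => lower t < 352202 ∧ -647799 < upper t),
      value γ t = (transf γ)^[K + i] u := by
    intro i
    obtain ⟨hlo, hhi⟩ := mem_Ico_scaled hγ (iterate_transf_mem_Ico hu (K + i))
    induction i with
    | zero =>
      obtain ⟨t, ht, hv⟩ := hreach K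
      rw [← hK] at hv
      rw [add_zero, ← hv] at hlo hhi
      refine ⟨t, ?_, hv⟩
      simp only [Function.iterate_zero, id, List.mem_filter, decide_eq_true_eq]
      exact ⟨ht, by exact_mod_cast (lower_le hγ t).trans_lt hhi,
        by exact_mod_cast hlo.trans_le (le_upper hγ t)⟩
    | succ i ih =>
      obtain ⟨hlo', hhi'⟩ := mem_Ico_scaled hγ (iterate_transf_mem_Ico hu (K + i))
      rw [Function.iterate_succ_apply']
      -- Both digits are tried at each state; the true remainder is always among the survivors.
      refine exists_mem_successors hγ (d := -digit γ u (K + i)) (ih hlo' hhi') ?_ ?_ hlo hhi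
      · rcases digit_eq_zero_or_one hγ hu (K + i) with h | h <;> simp [h]
      · rw [← add_assoc, iterate_transf_succ]; push_cast; ring
  obtain ⟨t, ht, hv⟩ := htail n
  have : t = 0 := by simpa using hT.2 ht
  rw [← hv, this]
  simp [value]

lemma expansion_add_eq_zero (hγ : γ ^ 3 - γ ^ 2 - γ - 1 = 0) {x y : ℝ}
    (hx : x ∈ negIntegers γ) (hy : y ∈ negIntegers γ) {j : ℤ} (hj : j < -((6 : ℕ) : ℤ)) :
    expansion γ (x + y) j = 0 := by
  have hβ := one_lt_tribonacci hγ
  obtain ⟨K, ⟨hKx, hKy⟩, hKz⟩ := ((eventually_div_pow_mem_Ioo hβ x).and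
    (eventually_div_pow_mem_Ioo hβ y)).and (eventually_div_pow_mem_Ioo hβ (x + y)) |>.exists
  have ux := Set.Ioo_subset_Ico_self hKx
  have uy := Set.Ioo_subset_Ico_self hKy
  have uz := Set.Ioo_subset_Ico_self hKz
  have hx0 := iterate_transf_eq_zero_of_mem_negIntegers hβ hx hKx
  have hy0 := iterate_transf_eq_zero_of_mem_negIntegers hβ hy hKy
  refine expansion_eq_zero_of_iterate hβ hKz (terminates_sum.iterate_eq_zero hγ
    (s := fun i => (transf γ)^[i] ((x + y) / (-γ) ^ K) - (transf γ)^[i] (x / (-γ) ^ K)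
      - (transf γ)^[i] (y / (-γ) ^ K))
    (d := fun i => -digit γ ((x + y) / (-γ) ^ K) i + digit γ (x / (-γ) ^ K) i
      + digit γ (y / (-γ) ^ K) i) ?_ ?_ ?_ ?_ uz ?_) hj
  · simp only [Function.iterate_zero, id]; ring
  · intro i
    simp only [iterate_transf_succ]; push_cast; ring
  · intro i
    rcases digit_eq_zero_or_one hγ ux i with h1 | h1 <;>
    rcases digit_eq_zero_or_one hγ uy i with h2 | h2 <;>
    rcases digit_eq_zero_or_one hγ uz i with h3 | h3 <;> simp [h1, h2, h3]
  · intro i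
    obtain ⟨h1, h2⟩ := mem_Ico_scaled hγ (iterate_transf_mem_Ico ux i)
    obtain ⟨h3, h4⟩ := mem_Ico_scaled hγ (iterate_transf_mem_Ico uy i)
    obtain ⟨h5, h6⟩ := mem_Ico_scaled hγ (iterate_transf_mem_Ico uz i)
    push_cast at *
    constructor <;> linarith
  · simp only [hx0, hy0, sub_zero]

lemma expansion_sub_eq_zero (hγ : γ ^ 3 - γ ^ 2 - γ - 1 = 0) {x y : ℝ}
    (hx : x ∈ negIntegers γ) (hy : y ∈ negIntegers γ) {j : ℤ} (hj : j < -((6 : ℕ) : ℤ)) :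
    expansion γ (x - y) j = 0 := by
  have hβ := one_lt_tribonacci hγ
  obtain ⟨K, ⟨hKx, hKy⟩, hKz⟩ := ((eventually_div_pow_mem_Ioo hβ x).and
    (eventually_div_pow_mem_Ioo hβ y)).and (eventually_div_pow_mem_Ioo hβ (x - y)) |>.exists
  have ux := Set.Ioo_subset_Ico_self hKx
  have uy := Set.Ioo_subset_Ico_self hKy
  have uz := Set.Ioo_subset_Ico_self hKz
  have hx0 := iterate_transf_eq_zero_of_mem_negIntegers hβ hx hKx
  have hy0 := iterate_transf_eq_zero_of_mem_negIntegers hβ hy hKy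
  refine expansion_eq_zero_of_iterate hβ hKz (terminates_difference.iterate_eq_zero hγ
    (s := fun i => (transf γ)^[i] ((x - y) / (-γ) ^ K) - (transf γ)^[i] (x / (-γ) ^ K)
      + (transf γ)^[i] (y / (-γ) ^ K))
    (d := fun i => -digit γ ((x - y) / (-γ) ^ K) i + digit γ (x / (-γ) ^ K) i
      - digit γ (y / (-γ) ^ K) i) ?_ ?_ ?_ ?_ uz ?_) hj
  · simp only [Function.iterate_zero, id]; ring
  · intro i
    simp only [iterate_transf_succ]; push_cast; ring
  · intro i
    rcases digit_eq_zero_or_one hγ ux i with h1 | h1 <;>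
    rcases digit_eq_zero_or_one hγ uy i with h2 | h2 <;>
    rcases digit_eq_zero_or_one hγ uz i with h3 | h3 <;> simp [h1, h2, h3]
  · intro i
    obtain ⟨h1, h2⟩ := mem_Ico_scaled hγ (iterate_transf_mem_Ico ux i)
    obtain ⟨h3, h4⟩ := mem_Ico_scaled hγ (iterate_transf_mem_Ico uy i)
    obtain ⟨h5, h6⟩ := mem_Ico_scaled hγ (iterate_transf_mem_Ico uz i)
    push_cast at *
    constructor <;> linarith
  · simp only [hx0, hy0, sub_zero, add_zero]

/-! ### The extremal example -/

lemma exists_negIntegers_add_eq (hγ : γ ^ 3 - γ ^ 2 - γ - 1 = 0) :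
    ∃ x ∈ negIntegers γ, ∃ y ∈ negIntegers γ, x + y = 2 * γ ^ 2 - γ + 2 := by
  -- The summands are `111• = γ² - γ + 1` and `11011• = γ² + 1`; the triples are the coordinates of
  -- their quotients by `(-γ)³` and `(-γ)⁵`.
  have hx : HasDigits [1, 1, 1] (-1, 4, -2) := by decide +kernel
  have hy : HasDigits [1, 1, 0, 1, 1] (-3, -4, 3) := by decide +kernel
  refine ⟨_, hx.mem_negIntegers hγ, _, hy.mem_negIntegers hγ, ?_⟩
  simp only [value, List.length_cons, List.length_nil]
  push_cast
  linear_combination (-3 * γ ^ 4 + γ ^ 3 + 3 * γ ^ 2 - 3 * γ + 2) * hγ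

lemma expansion_extremal (hγ : γ ^ 3 - γ ^ 2 - γ - 1 = 0) (j : ℤ) :
    expansion γ (2 * γ ^ 2 - γ + 2) j =
      if j ∈ ({4, 3, 2, 1, -2, -3, -6} : Finset ℤ) then 1 else 0 := by
  -- Five integer digits and six fractional ones; the triple represents the number divided by
  -- `(-γ)⁵`.
  have hz : HasDigits [1, 1, 1, 1, 0, 0, 1, 1, 0, 0, 1] (-9, -10, 8) := by decide +kernel
  have he : 2 * γ ^ 2 - γ + 2 = (-γ) ^ 5 * value γ (-9, -10, 8) := by
    simp only [value]
    push_cast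
    linear_combination (8 * γ ^ 4 - 2 * γ ^ 3 - 3 * γ ^ 2 + 3 * γ - 2) * hγ
  rw [he, hz.expansion_eq hγ]
  by_cases h1 : 5 ≤ j
  · rw [if_neg (by push_cast; omega), if_neg]
    simp only [Finset.mem_insert, Finset.mem_singleton]
    omega
  by_cases h2 : j < -6
  · rw [if_pos (by push_cast; omega), if_neg, List.getD_eq_default]
    · simp only [List.length_cons, List.length_nil]
      omega
    · simp only [Finset.mem_insert, Finset.mem_singleton]
      omega
  · push Not at h1 h2
    interval_cases j <;> decide

lemma fr_extremal (hγ : γ ^ 3 - γ ^ 2 - γ - 1 = 0) : fr γ (2 * γ ^ 2 - γ + 2) = 6 := by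
  refine le_antisymm (fr_le (n := 6) fun j hj => ?_) (le_fr (n := 6) ?_)
  · rw [expansion_extremal hγ, if_neg]
    simp only [Finset.mem_insert, Finset.mem_singleton]
    omega
  · rw [expansion_extremal hγ]
    decide

end Tribonacci

end ItoSadahiro

open ItoSadahiro in
theorem theorem1 (γ : ℝ) (hγ : γ ^ 3 - γ ^ 2 - γ - 1 = 0) :
    (∀ x ∈ ItoSadahiro.negIntegers γ, ∀ y ∈ ItoSadahiro.negIntegers γ,
      (x + y ∈ ItoSadahiro.negFin γ ∧ ItoSadahiro.fr γ (x + y) ≤ 6) ∧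
      (-x ∈ ItoSadahiro.negFin γ ∧ ItoSadahiro.fr γ (-x) ≤ 6) ∧
      (x - y ∈ ItoSadahiro.negFin γ ∧ ItoSadahiro.fr γ (x - y) ≤ 6)) ∧
    ((∃ x ∈ ItoSadahiro.negIntegers γ, ∃ y ∈ ItoSadahiro.negIntegers γ,
        x + y = 2 * γ ^ 2 - γ + 2) ∧
      (∀ j : ℤ, ItoSadahiro.expansion γ (2 * γ ^ 2 - γ + 2) j =
        if j ∈ ({4, 3, 2, 1, -2, -3, -6} : Finset ℤ) then 1 else 0) ∧
      ItoSadahiro.fr γ (2 * γ ^ 2 - γ + 2) = 6) ∧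
    ItoSadahiro.LPlus γ = 6 := by
  have hadd : ∀ x ∈ negIntegers γ, ∀ y ∈ negIntegers γ,
      x + y ∈ negFin γ ∧ fr γ (x + y) ≤ 6 := fun x hx y hy =>
    ⟨⟨6, fun _ hj => expansion_add_eq_zero hγ hx hy hj⟩,
      fr_le (n := 6) fun _ hj => expansion_add_eq_zero hγ hx hy hj⟩
  have hsub : ∀ x ∈ negIntegers γ, ∀ y ∈ negIntegers γ,
      x - y ∈ negFin γ ∧ fr γ (x - y) ≤ 6 := fun x hx y hy =>
    ⟨⟨6, fun _ hj => expansion_sub_eq_zero hγ hx hy hj⟩,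
      fr_le (n := 6) fun _ hj => expansion_sub_eq_zero hγ hx hy hj⟩
  refine ⟨fun x hx y hy => ⟨hadd x hx y hy, ?_, hsub x hx y hy⟩,
    ⟨exists_negIntegers_add_eq hγ, expansion_extremal hγ, fr_extremal hγ⟩, le_antisymm ?_ ?_⟩
  -- The opposite is the difference `0 - x`.
  · simpa using hsub 0 (zero_mem_negIntegers (one_lt_tribonacci hγ)) x hx
  · refine sSup_le ?_
    rintro n ⟨x, hx, y, hy, z, rfl | rfl, -, rfl⟩
    · exact (hadd x hx y hy).2
    · exact (hsub x hx y hy).2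
  · obtain ⟨x, hx, y, hy, hxy⟩ := exists_negIntegers_add_eq hγ
    exact le_sSup ⟨x, hx, y, hy, _, Or.inl rfl, (hadd x hx y hy).1, by rw [hxy, fr_extremal hγ]⟩
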